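/- Let $p$ be a positive integer, let $X=(X_1,\ldots,X_p)$ and $\widetilde X=(\widetilde X_1,\ldots,\widetilde X_p)$ be random vectors in $\mathbb{R}^p$ and $Y$ a real random variable, all on the same probability space. Suppose that $\widetilde X$ is a knockoff copy of $X$, that is: (i) for each $i\in\{1,\ldots,p\}$, the law of $(X,\widetilde X)$ on $\mathbb{R}^{2p}$ does not change when its $i$-th and its $(p+i)$-th coordinates are swapped; and (ii) $\widetilde X$ is conditionally independent of $Y$ given $X$. Then the following two conditions are equivalent. (a) $\widetilde X$ is a conditional independence knockoff of $X$: there are a measurable space $\Theta$, a probability measure $\gamma$ on $\Theta$ and, for each $i=1,\ldots,p$, a Markov kernel $P_i(\cdot\mid\theta)$ from $\Theta$ to $\mathbb{R}$ such that $$P(X_1\in A_1,\ldots,X_p\in A_p,\widetilde X_1\in B_1,\ldots,\widetilde X_p\in B_p)=\int_\Theta\prod_{i=1}^p P_i(A_i\mid\theta)\,P_i(B_i\mid\theta)\,\gamma(d\theta)$$ for all Borel sets $A_1,\ldots,A_p,B_1,\ldots,B_p\subset\mathbb{R}$. (b) $(X,\widetilde X)$ is infinitely extendable: there is, on some probability space,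 an infinite sequence $V=(V_1,V_2,\ldots)$ of real random variables such that $(V_1,\ldots,V_{2p})\sim(X,\widetilde X)$ and, for all integers $1\le i\le p$ and $j,k\ge 0$, the sequence obtained from $V$ by swapping $V_{kp+i}$ with $V_{jp+i}$ and leaving all other elements fixed has the same law as $V$. -/

import Mathlib

open MeasureTheory ProbabilityTheory

universe u v w

/-- The vector `(X, X̃)` of `ℝ^{2p}`: its coordinate `i` is `X_i` and its coordinate `p + i`
is `X̃_i`, for `i = 0, …, p - 1`. -/
def joinVec {Ω : Type u} {p : ℕ} (X Xt : Ω → Fin p → ℝ) : Ω → Fin (p + p) → ℝ :=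
  fun ω => Fin.append (X ω) (Xt ω)

/-- The map `f_i : ℝ^{2p} → ℝ^{2p}` that swaps the coordinates `i` and `p + i` and leaves all
other coordinates fixed. -/
def swapCoord {p : ℕ} (i : Fin p) (x : Fin (p + p) → ℝ) : Fin (p + p) → ℝ :=
  fun r => x (Equiv.swap (Fin.castAdd p i) (Fin.natAdd p i) r)

/-- Conditional independence of the random elements `U` and `W` given the random element `T`:
`P(U ∈ s, W ∈ t | T) = P(U ∈ s | T) P(W ∈ t | T)` almost surely, for all measurable `s`, `t`.
No assumption on the underlying probability space is needed. -/
def CondIndepGiven {Ω : Type u} [MeasurableSpace Ω] {α β γ : Type*} [MeasurableSpace α]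
    [MeasurableSpace β] [mγ : MeasurableSpace γ] (U : Ω → α) (W : Ω → β) (T : Ω → γ)
    (μ : Measure Ω) : Prop :=
  ∀ (s : Set α) (t : Set β), MeasurableSet s → MeasurableSet t →
    μ⟦U ⁻¹' s ∩ W ⁻¹' t | mγ.comap T⟧ =ᵐ[μ]
      μ⟦U ⁻¹' s | mγ.comap T⟧ * μ⟦W ⁻¹' t | mγ.comap T⟧

/-- `Xt` is a knockoff copy of the vector `X` of explanatory variables, `Y` being the response
variable. -/
structure IsKnockoff {Ω : Type u} [MeasurableSpace Ω] {p : ℕ} (X Xt : Ω → Fin p → ℝ)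
    (Y : Ω → ℝ) (μ : Measure Ω) : Prop where
  /-- `f_i (X, X̃) ∼ (X, X̃)` for each `i`. -/
  swap_invariant : ∀ i : Fin p,
    IdentDistrib (fun ω => swapCoord i (joinVec X Xt ω)) (joinVec X Xt) μ μ
  /-- `X̃` is independent of `Y` given `X`. -/
  condIndep : CondIndepGiven Xt Y X μ

/-- `Xt` is a conditional independence knockoff of `X`: there are a measurable space `Θ`, a
probability measure `γ` on `Θ` and Markov kernels `P_i(· | θ)` from `Θ` to `ℝ` with
`P(X_i ∈ A_i, X̃_i ∈ B_i for all i) = ∫ ∏_i P_i(A_i | θ) P_i(B_i | θ) γ(dθ)`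
for all Borel sets `A_i`, `B_i`. -/
def IsCIK {Ω : Type u} [MeasurableSpace Ω] {p : ℕ} (X Xt : Ω → Fin p → ℝ)
    (μ : Measure Ω) : Prop :=
  ∃ (Θ : Type w) (_ : MeasurableSpace Θ) (γ : Measure Θ) (P : Fin p → Kernel Θ ℝ),
    IsProbabilityMeasure γ ∧ (∀ i, IsMarkovKernel (P i)) ∧
    ∀ A B : Fin p → Set ℝ, (∀ i, MeasurableSet (A i)) → (∀ i, MeasurableSet (B i)) →
      μ {ω | (∀ i, X ω i ∈ A i) ∧ (∀ i, Xt ω i ∈ B i)} =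
        ∫⁻ θ, ∏ i, (P i θ (A i) * P i θ (B i)) ∂γ

/-- The sequence obtained from `x` by swapping the elements of indices `k p + i` and `j p + i`
and leaving all other elements fixed. Sequences and positions `i` are numbered from `0`. -/
def swapSeq {p : ℕ} (i : Fin p) (j k : ℕ) (x : ℕ → ℝ) : ℕ → ℝ :=
  fun r => x (Equiv.swap (k * p + i) (j * p + i) r)

/-- `(X, Xt)` is infinitely extendable: on some probability space there is an infinite sequence
`V` of real random variables whose first `2p` elements are distributed as `(X, Xt)` and whose
law is invariant under all the swaps `swapSeq i j k`. -/
def InfinitelyExtendable {Ω : Type u} [MeasurableSpace Ω] {p : ℕ} (X Xt : Ω → Fin p → ℝ)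
    (μ : Measure Ω) : Prop :=
  ∃ (Ω' : Type v) (_ : MeasurableSpace Ω') (ν : Measure Ω') (V : Ω' → ℕ → ℝ),
    IsProbabilityMeasure ν ∧ Measurable V ∧
    IdentDistrib (fun ω (r : Fin (p + p)) => V ω r) (joinVec X Xt) ν μ ∧
    ∀ (i : Fin p) (j k : ℕ), IdentDistrib (fun ω => swapSeq i j k (V ω)) V ν ν

/-!
Each of the two conditions says that `(X, X̃)` has the law of the first two rows of an infinite
array with `p` types of elements: in (a) the elements of the array are independent given `θ`, with a
law depending only on their type; in (b) elements of the same type can be swapped without changing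
the law of the array. By de Finetti's theorem for several types these are the same arrays.

To prove it for an exchangeable array, condition on its odd rows. Given these, the conditional law
of an element of an even row does not change when one conditions further on other elements of even
rows: moving everything but that element into the odd rows shows that the finer conditional
probability has the same law as a coarser one, and a martingale of two terms with equal second
moments is constant. So the elements of the even rows are conditionally independent, by symmetry
their conditional laws depend only on their types, and the even rows have the law of the whole
array.
-/

section Measure

variable {κ : Type*} {E : κ → Type*} [∀ a, MeasurableSpace (E a)]

theorem measurableSet_finset_pi (S : Finset κ) {A : ∀ a, Set (E a)}
    (hA : ∀ a, MeasurableSet (A a)) : MeasurableSet ((S : Set κ).pi A) :=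
  MeasurableSet.pi S.countable_toSet fun a _ => hA a

theorem measurable_comp_index {κ κ' E : Type*} [MeasurableSpace E] (ρ : κ' → κ) :
    Measurable fun x : κ → E => x ∘ ρ :=
  measurable_pi_lambda _ fun _ => measurable_pi_apply _

theorem measurable_extend_index {κ κ' E : Type*} [MeasurableSpace E] (f : κ → κ') (y : κ' → E) :
    Measurable fun x : κ → E => Function.extend f x y := by
  refine measurable_pi_lambda _ fun z => ?_
  unfold Function.extend
  split_ifs
  exacts [measurable_pi_apply _, measurable_const]

theorem identDistrib_comp_map {Ω α β : Type*} [MeasurableSpace Ω] [MeasurableSpace α]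
    [MeasurableSpace β] {μ : Measure Ω} {f : Ω → α} {g : α → β} (hg : Measurable g)
    (hf : Measurable f) : IdentDistrib (fun ω => g (f ω)) g μ (μ.map f) where
  aemeasurable_fst := (hg.comp hf).aemeasurable
  aemeasurable_snd := hg.aemeasurable
  map_eq := (Measure.map_map hg hf).symm

theorem ext_of_finset_pi {μ ν : Measure (∀ a, E a)} [IsProbabilityMeasure μ]
    [IsProbabilityMeasure ν]
    (h : ∀ (S : Finset κ) (A : ∀ a, Set (E a)), (∀ a, MeasurableSet (A a)) →
      μ ((S : Set κ).pi A) = ν ((S : Set κ).pi A)) : μ = ν := by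
  refine ext_of_generate_finite _ generateFrom_squareCylinders.symm
    (isPiSystem_squareCylinders (fun _ => MeasurableSpace.isPiSystem_measurableSet) (by simp))
    ?_ (by simp)
  rintro _ ⟨S, A, hA, rfl⟩
  exact h S A fun a => hA a (Set.mem_univ a)

theorem measurable_infinitePi {Θ : Type*} [MeasurableSpace Θ] (Q : ∀ a, Kernel Θ (E a))
    [∀ a, IsMarkovKernel (Q a)] : Measurable fun θ => Measure.infinitePi fun a => Q a θ := by
  refine Measurable.measure_of_isPiSystem_of_isProbabilityMeasure
    generateFrom_squareCylinders.symm
    (isPiSystem_squareCylinders (fun _ => MeasurableSpace.isPiSystem_measurableSet) (by simp)) ?_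
  rintro _ ⟨S, A, hA, rfl⟩
  have mA : ∀ a, MeasurableSet (A a) := fun a => hA a (Set.mem_univ a)
  simp_rw [Measure.infinitePi_pi _ fun a _ => mA a]
  exact Finset.measurable_fun_prod _ fun a _ => Kernel.measurable_coe _ (mA a)

/-- The mixture over `γ` of the laws of arrays of independent random elements with laws `Q a θ`. -/
noncomputable def mixedProduct {Θ : Type*} [MeasurableSpace Θ] (γ : Measure Θ)
    (Q : ∀ a, Kernel Θ (E a)) [∀ a, IsMarkovKernel (Q a)] : Measure (∀ a, E a) :=
  γ.bind fun θ => Measure.infinitePi fun a => Q a θ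

section MixedProduct

variable {Θ : Type*} [MeasurableSpace Θ] (γ : Measure Θ)

instance [IsProbabilityMeasure γ] (Q : ∀ a, Kernel Θ (E a)) [∀ a, IsMarkovKernel (Q a)] :
    IsProbabilityMeasure (mixedProduct γ Q) :=
  isProbabilityMeasure_bind (measurable_infinitePi Q).aemeasurable
    (.of_forall fun _ => inferInstance)

theorem mixedProduct_pi (Q : ∀ a, Kernel Θ (E a)) [∀ a, IsMarkovKernel (Q a)] (S : Finset κ)
    {A : ∀ a, Set (E a)} (hA : ∀ a, MeasurableSet (A a)) :
    mixedProduct γ Q ((S : Set κ).pi A) = ∫⁻ θ, ∏ a ∈ S, Q a θ (A a) ∂γ := by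
  rw [mixedProduct, Measure.bind_apply (measurableSet_finset_pi S hA)
    (measurable_infinitePi Q).aemeasurable]
  simp_rw [Measure.infinitePi_pi _ fun a _ => hA a]

theorem mixedProduct_map {Θ' : Type*} [MeasurableSpace Θ'] {f : Θ → Θ'} (hf : Measurable f)
    (Q : ∀ a, Kernel Θ' (E a)) [∀ a, IsMarkovKernel (Q a)] :
    mixedProduct (γ.map f) Q = mixedProduct γ fun a => (Q a).comap f hf := by
  refine Measure.ext fun s hs => ?_
  simp only [mixedProduct]
  rw [Measure.bind_apply hs (measurable_infinitePi Q).aemeasurable,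
    Measure.bind_apply hs (measurable_infinitePi fun a => (Q a).comap f hf).aemeasurable]
  exact lintegral_map ((Measure.measurable_coe hs).comp (measurable_infinitePi Q)) hf

theorem map_comp_perm_mixedProduct {F : Type*} [MeasurableSpace F] [IsProbabilityMeasure γ]
    (σ : Equiv.Perm κ) (Q : κ → Kernel Θ F) [∀ a, IsMarkovKernel (Q a)] :
    (mixedProduct γ Q).map (fun x => x ∘ σ) = mixedProduct γ fun a => Q (σ a) := by
  have mσ : Measurable fun x : κ → F => x ∘ σ := measurable_comp_index σ
  have := Measure.isProbabilityMeasure_map (μ := mixedProduct γ Q) mσ.aemeasurable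
  refine ext_of_finset_pi fun S A hA => ?_
  have preimage_eq : (fun x : κ → F => x ∘ σ) ⁻¹' (S : Set κ).pi A =
      (S.map σ.toEmbedding : Set κ).pi fun a => A (σ.symm a) := by
    ext x
    simp [Set.mem_pi, ← σ.forall_congr_right (q := fun i => σ.symm i ∈ S → x i ∈ A (σ.symm i))]
  rw [Measure.map_apply mσ (measurableSet_finset_pi S hA), preimage_eq,
    mixedProduct_pi γ Q _ fun a => hA _, mixedProduct_pi γ _ S hA]
  simp only [Finset.prod_map, Equiv.coe_toEmbedding, Equiv.symm_apply_apply]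

end MixedProduct

end Measure

section CondExp

variable {Ω : Type*} {m₁ m₂ m₃ m₀ : MeasurableSpace Ω} {μ : Measure Ω}

theorem measure_eq_lintegral_ofReal_condExp [IsFiniteMeasure μ] (hm : m₁ ≤ m₀) {s : Set Ω}
    (hs : MeasurableSet s) : μ s = ∫⁻ ω, ENNReal.ofReal ((μ⟦s | m₁⟧) ω) ∂μ := by
  rw [← ofReal_integral_eq_lintegral_ofReal integrable_condExp
      (condExp_nonneg (.of_forall fun _ => Set.indicator_nonneg (fun _ _ => zero_le_one) _)),
    integral_condExp hm, integral_indicator_const _ hs, smul_eq_mul, mul_one, ofReal_measureReal]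

theorem condExp_ae_eq_of_le_of_le [IsFiniteMeasure μ] (h₁₂ : m₁ ≤ m₂) (h₂₃ : m₂ ≤ m₃)
    (h₃ : m₃ ≤ m₀) {f : Ω → ℝ} (h : μ[f | m₃] =ᵐ[μ] μ[f | m₁]) :
    μ[f | m₃] =ᵐ[μ] μ[f | m₂] :=
  calc μ[f | m₃] =ᵐ[μ] μ[f | m₁] := h
    _ = μ[μ[f | m₁] | m₂] := (condExp_of_stronglyMeasurable (h₂₃.trans h₃)
      (stronglyMeasurable_condExp.mono h₁₂) integrable_condExp).symm
    _ =ᵐ[μ] μ[μ[f | m₃] | m₂] := condExp_congr_ae h.symm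
    _ =ᵐ[μ] μ[f | m₂] := condExp_condExp_of_le h₂₃ h₃

theorem condExp_mul_ae_eq_mul_of_condExp_ae_eq [IsFiniteMeasure μ] (h₁₂ : m₁ ≤ m₂)
    (h₂ : m₂ ≤ m₀) {f g : Ω → ℝ} (hf : Integrable f μ) (hg : Integrable g μ)
    (hfg : Integrable (f * g) μ) (hgm : StronglyMeasurable[m₂] g)
    (h : μ[f | m₂] =ᵐ[μ] μ[f | m₁]) :
    μ[f * g | m₁] =ᵐ[μ] μ[f | m₁] * μ[g | m₁] := by
  have pull : μ[f * g | m₂] =ᵐ[μ] μ[f | m₁] * g :=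
    (condExp_mul_of_stronglyMeasurable_right hgm hfg hf).trans (h.mul .rfl)
  calc μ[f * g | m₁] =ᵐ[μ] μ[μ[f * g | m₂] | m₁] := (condExp_condExp_of_le h₁₂ h₂).symm
    _ =ᵐ[μ] μ[μ[f | m₁] * g | m₁] := condExp_congr_ae pull
    _ =ᵐ[μ] μ[f | m₁] * μ[g | m₁] := condExp_mul_of_stronglyMeasurable_left
      stronglyMeasurable_condExp (integrable_condExp.congr pull) hg

theorem condExp_inter_ae_eq_mul [IsFiniteMeasure μ] (h₁₂ : m₁ ≤ m₂) (h₂ : m₂ ≤ m₀)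
    {s t : Set Ω} (hs : MeasurableSet s) (ht : MeasurableSet[m₂] t)
    (h : μ⟦s | m₂⟧ =ᵐ[μ] μ⟦s | m₁⟧) : μ⟦s ∩ t | m₁⟧ =ᵐ[μ] μ⟦s | m₁⟧ * μ⟦t | m₁⟧ := by
  have indicator_eq : (s ∩ t).indicator (fun _ => (1 : ℝ)) =
      s.indicator (fun _ => 1) * t.indicator (fun _ => 1) := Set.inter_indicator_one
  have integrable_indicator {u : Set Ω} (hu : MeasurableSet u) :
      Integrable (u.indicator fun _ => (1 : ℝ)) μ := (integrable_const 1).indicator hu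
  rw [indicator_eq]
  refine condExp_mul_ae_eq_mul_of_condExp_ae_eq h₁₂ h₂ (integrable_indicator hs)
    (integrable_indicator (h₂ t ht)) ?_ (stronglyMeasurable_const.indicator ht) h
  rw [← indicator_eq]
  exact integrable_indicator (hs.inter (h₂ t ht))

/-- By Pythagoras, the squared `L²` distance between the two conditional expectations is the
difference of their variances. -/
theorem condExp_ae_eq_of_identDistrib [IsProbabilityMeasure μ] (h₁₂ : m₁ ≤ m₂) (h₂ : m₂ ≤ m₀)
    {f : Ω → ℝ} (hf : MemLp f 2 μ) (h : IdentDistrib (μ[f | m₁]) (μ[f | m₂]) μ μ) :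
    μ[f | m₂] =ᵐ[μ] μ[f | m₁] := by
  have tower : μ[μ[f | m₂] | m₁] =ᵐ[μ] μ[f | m₁] := condExp_condExp_of_le h₁₂ h₂
  have hf₂ : MemLp (μ[f | m₂]) 2 μ := hf.condExp (by norm_num)
  have hsq : Integrable ((μ[f | m₂] - μ[μ[f | m₂] | m₁]) ^ 2) μ :=
    (hf₂.sub (hf₂.condExp (by norm_num))).integrable_sq
  have dist_eq_zero : ∫ ω, ((μ[f | m₂] - μ[μ[f | m₂] | m₁]) ^ 2) ω ∂μ = 0 := by
    have total := integral_condVar_add_variance_condExp (h₁₂.trans h₂) hf₂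
    rw [variance_congr tower, h.variance_eq, add_eq_right, condVar,
      integral_condExp (h₁₂.trans h₂)] at total
    exact total
  have ae_zero := (integral_eq_zero_iff_of_nonneg (fun ω => sq_nonneg _) hsq).1 dist_eq_zero
  filter_upwards [ae_zero, tower] with ω hω htower
  rw [← htower]
  exact sub_eq_zero.1 (pow_eq_zero_iff two_ne_zero |>.1 hω)

end CondExp

section CondExpPreimage

variable {Ω S α : Type*} [MeasurableSpace Ω] [mS : MeasurableSpace S] [MeasurableSpace α]
  [StandardBorelSpace α] [Nonempty α] {μ : Measure Ω}

theorem identDistrib_condExp_preimage {Ω' : Type*} [MeasurableSpace Ω'] {ν : Measure Ω'}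
    [IsFiniteMeasure μ] [IsFiniteMeasure ν]
    {T : Ω → S} {Z : Ω → α} {T' : Ω' → S} {Z' : Ω' → α} (hT : Measurable T) (hZ : Measurable Z)
    (hT' : Measurable T') (hZ' : Measurable Z')
    (h : IdentDistrib (fun ω => (T ω, Z ω)) (fun ω => (T' ω, Z' ω)) μ ν) {s : Set α}
    (hs : MeasurableSet s) :
    IdentDistrib (μ⟦Z ⁻¹' s | mS.comap T⟧) (ν⟦Z' ⁻¹' s | mS.comap T'⟧) μ ν := by
  have cond_eq : condDistrib Z T μ = condDistrib Z' T' ν := by simp only [condDistrib, h.map_eq]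
  have hφ : Measurable fun t => (condDistrib Z T μ t).real s :=
    (Kernel.measurable_coe _ hs).ennreal_toReal
  have hφT : IdentDistrib (fun ω => (condDistrib Z T μ (T ω)).real s)
      (fun ω => (condDistrib Z T μ (T' ω)).real s) μ ν := h.comp (hφ.comp measurable_fst)
  have ae_T := condDistrib_ae_eq_condExp (μ := μ) hT hZ hs
  have ae_T' := condDistrib_ae_eq_condExp (μ := ν) hT' hZ' hs
  rw [← cond_eq] at ae_T'
  exact ((IdentDistrib.of_ae_eq (hφ.comp hT).aemeasurable ae_T).symm.trans hφT).trans
    (IdentDistrib.of_ae_eq (hφ.comp hT').aemeasurable ae_T')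

theorem condExp_preimage_ae_eq_of_identDistrib [IsProbabilityMeasure μ] {T T' : Ω → S}
    {Z : Ω → α} (hT : Measurable T) (hT' : Measurable T') (hZ : Measurable Z)
    (hle : mS.comap T' ≤ mS.comap T)
    (h : IdentDistrib (fun ω => (T ω, Z ω)) (fun ω => (T' ω, Z ω)) μ μ) {s : Set α}
    (hs : MeasurableSet s) :
    μ⟦Z ⁻¹' s | mS.comap T⟧ =ᵐ[μ] μ⟦Z ⁻¹' s | mS.comap T'⟧ :=
  condExp_ae_eq_of_identDistrib hle hT.comap_le
    (memLp_indicator_const 2 (hZ hs) 1 (.inr (measure_ne_top μ _)))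
    (identDistrib_condExp_preimage hT hZ hT' hZ h hs).symm

end CondExpPreimage

section PartiallyExchangeable

variable {ι E : Type*} [MeasurableSpace E]

/-- Partial exchangeability, in the sense of de Finetti, of the law `L` of an array of random
elements: the index `(k, i)` is the `k`-th element of type `i`, and elements of the same type can be
swapped without changing the law. -/
def PartiallyExchangeable [DecidableEq ι] (L : Measure (ℕ × ι → E)) : Prop :=
  ∀ (i : ι) (j k : ℕ), L.map (fun x => x ∘ Equiv.swap (k, i) (j, i)) = L

theorem comap_comp_index_le {κ κ' κ'' : Type*} (ρ : κ' → κ) (τ : κ'' → κ') :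
    MeasurableSpace.pi.comap (fun x : κ → E => x ∘ (ρ ∘ τ)) ≤
      MeasurableSpace.pi.comap fun x : κ → E => x ∘ ρ :=
  ((measurable_comp_index τ).comp (comap_measurable fun x : κ → E => x ∘ ρ)).comap_le

theorem measurableSet_comap_preimage_pi {κ κ' : Type*} {U : Set κ} {τ : κ' → κ} {S : Finset κ'}
    (hτ : ∀ b ∈ S, τ b ∈ U) {A : κ' → Set E} (hA : ∀ b, MeasurableSet (A b)) :
    MeasurableSet[MeasurableSpace.pi.comap fun x : κ → E => x ∘ ((↑) : U → κ)]
      ((fun x => x ∘ τ) ⁻¹' (S : Set κ').pi A) := by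
  have preimage_eq : (fun x : κ → E => x ∘ τ) ⁻¹' (S : Set κ').pi A =
      (fun x => x ∘ ((↑) : U → κ)) ⁻¹'
        ⋂ b : S, (fun y => y ⟨τ b, hτ b b.2⟩) ⁻¹' A b := by
    ext x
    simp
  rw [preimage_eq]
  exact comap_measurable _ (MeasurableSet.iInter fun b => measurable_pi_apply _ (hA b))

/-- The embedding of the array indices onto those of the elements with an even number. In a
partially exchangeable array, these are conditionally independent given the elements with an odd
number. -/
def evenIndex : ℕ × ι → ℕ × ι := Prod.map (2 * ·) id

/-- The embedding of the array indices onto those of the elements with an odd number. The directing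
measure of a partially exchangeable array is read off the elements with an odd number. -/
def oddIndex : ℕ × ι → ℕ × ι := Prod.map (2 * · + 1) id

theorem evenIndex_injective : Function.Injective (evenIndex (ι := ι)) :=
  Function.Injective.prodMap (fun k l h => by grind) Function.injective_id

theorem oddIndex_injective : Function.Injective (oddIndex (ι := ι)) :=
  Function.Injective.prodMap (fun k l h => by grind) Function.injective_id

theorem oddIndex_ne_evenIndex (a b : ℕ × ι) : oddIndex a ≠ evenIndex b := fun h => by
  have := congrArg Prod.fst h
  simp only [oddIndex, evenIndex, Prod.map_fst] at this
  omega

theorem snd_swap_apply {κ ι : Type*} [DecidableEq (κ × ι)] {a b : κ × ι} (h : a.2 = b.2)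
    (c : κ × ι) : (Equiv.swap a b c).2 = c.2 := by
  rw [Equiv.swap_apply_def]
  split_ifs with hca hcb
  · rw [hca, h]
  · rw [hcb, h]
  · rfl

namespace PartiallyExchangeable

variable [DecidableEq ι] {L : Measure (ℕ × ι → E)}

theorem exists_perm_eqOn (hL : PartiallyExchangeable L) {ρ : ℕ × ι → ℕ × ι}
    (hρ : Function.Injective ρ) (hsnd : ∀ a, (ρ a).2 = a.2) (S : Finset (ℕ × ι)) :
    ∃ σ : Equiv.Perm (ℕ × ι), Set.EqOn σ ρ S ∧ (∀ a, (σ a).2 = a.2) ∧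
      L.map (fun x => x ∘ σ) = L := by
  induction S using Finset.induction_on with
  | empty => exact ⟨1, by simp, by simp, Measure.map_id⟩
  | insert a S ha ih =>
    obtain ⟨σ, hσρ, hσ, hσL⟩ := ih
    have type_eq : (σ a).2 = (ρ a).2 := (hσ a).trans (hsnd a).symm
    refine ⟨Equiv.swap (σ a) (ρ a) * σ, fun b hb => ?_, fun b => ?_, ?_⟩
    · rcases Finset.mem_insert.1 hb with rfl | hbS
      · exact Equiv.swap_apply_left _ _
      · have hba : b ≠ a := fun h => ha (h ▸ hbS)
        have hσba : ρ b ≠ σ a := hσρ hbS ▸ σ.injective.ne hba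
        rw [Equiv.Perm.mul_apply, hσρ hbS, Equiv.swap_apply_of_ne_of_ne hσba (hρ.ne hba)]
    · exact (snd_swap_apply type_eq (σ b)).trans (hσ b)
    · have swap_eq : L.map (fun x => x ∘ Equiv.swap (σ a) (ρ a)) = L := by
        have := hL (σ a).2 (ρ a).1 (σ a).1
        rwa [Prod.mk.eta, type_eq, Prod.mk.eta] at this
      calc L.map (fun x => x ∘ (Equiv.swap (σ a) (ρ a) * σ))
          = (L.map fun x => x ∘ Equiv.swap (σ a) (ρ a)).map fun x => x ∘ σ :=
            (Measure.map_map (measurable_comp_index (E := E) σ)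
              (measurable_comp_index (Equiv.swap (σ a) (ρ a)))).symm
        _ = L := by rw [swap_eq, hσL]

variable [IsProbabilityMeasure L]

theorem map_comp_of_injective (hL : PartiallyExchangeable L) {ρ : ℕ × ι → ℕ × ι}
    (hρ : Function.Injective ρ) (hsnd : ∀ a, (ρ a).2 = a.2) : L.map (fun x => x ∘ ρ) = L := by
  have := Measure.isProbabilityMeasure_map (μ := L) (measurable_comp_index ρ).aemeasurable
  refine ext_of_finset_pi fun S A hA => ?_
  obtain ⟨σ, hσρ, -, hσL⟩ := hL.exists_perm_eqOn hρ hsnd S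
  have preimage_eq : (fun x : ℕ × ι → E => x ∘ ρ) ⁻¹' (S : Set _).pi A =
      (fun x => x ∘ σ) ⁻¹' (S : Set _).pi A := by
    ext x
    exact forall₂_congr fun a ha => by simp only [Function.comp_apply, hσρ ha]
  calc L.map (fun x => x ∘ ρ) ((S : Set _).pi A)
      = L.map (fun x => x ∘ σ) ((S : Set _).pi A) := by
        rw [Measure.map_apply (measurable_comp_index ρ) (measurableSet_finset_pi S hA),
          Measure.map_apply (measurable_comp_index σ) (measurableSet_finset_pi S hA), preimage_eq]
    _ = L ((S : Set _).pi A) := by rw [hσL]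

theorem identDistrib_comp (hL : PartiallyExchangeable L) {ρ : ℕ × ι → ℕ × ι}
    (hρ : Function.Injective ρ) (hsnd : ∀ a, (ρ a).2 = a.2) {β : Type*} [MeasurableSpace β]
    {f : (ℕ × ι → E) → β} (hf : Measurable f) : IdentDistrib f (fun x => f (x ∘ ρ)) L L where
  aemeasurable_fst := hf.aemeasurable
  aemeasurable_snd := (hf.comp (measurable_comp_index ρ)).aemeasurable
  map_eq := by
    conv_lhs => rw [← hL.map_comp_of_injective hρ hsnd]
    exact Measure.map_map hf (measurable_comp_index ρ)

theorem identDistrib_prodMk_shift (hL : PartiallyExchangeable L) {U : Set (ℕ × ι)} {a : ℕ × ι}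
    (ha : evenIndex a ∉ U) :
    IdentDistrib (fun x => (x ∘ ((↑) : U → ℕ × ι), x (evenIndex a)))
      (fun x => (x ∘ (oddIndex ∘ ((↑) : U → ℕ × ι)), x (evenIndex a))) L L := by
  let ρ : ℕ × ι → ℕ × ι := fun b => if b = evenIndex a then b else oddIndex b
  have hρ : Function.Injective ρ := fun b c hbc => by
    simp only [ρ] at hbc
    split_ifs at hbc with hb hc hc
    · exact hbc
    · exact absurd (hbc.symm.trans hb) (oddIndex_ne_evenIndex c a)
    · exact absurd (hbc.trans hc) (oddIndex_ne_evenIndex b a)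
    · exact oddIndex_injective hbc
  have hsnd : ∀ b, (ρ b).2 = b.2 := fun b => by
    simp only [ρ]
    split_ifs <;> rfl
  have fix_a : ρ (evenIndex a) = evenIndex a := if_pos rfl
  have shift_U : ρ ∘ ((↑) : U → ℕ × ι) = oddIndex ∘ (↑) :=
    funext fun u => if_neg fun h : u.1 = evenIndex a => ha (h ▸ u.2)
  have joint := hL.identDistrib_comp hρ hsnd
    ((measurable_comp_index ((↑) : U → ℕ × ι)).prodMk (measurable_pi_apply (evenIndex a)))
  simpa only [Function.comp_assoc, Function.comp_apply, fix_a, shift_U] using joint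

variable [StandardBorelSpace E] [Nonempty E]

theorem condDistrib_evenIndex (hL : PartiallyExchangeable L) (a : ℕ × ι) :
    condDistrib (fun x => x (evenIndex a)) (fun x => x ∘ oddIndex) L =
      condDistrib (fun x => x (0, a.2)) (fun x => x ∘ oddIndex) L := by
  set ρ := Equiv.swap (evenIndex a) (0, a.2)
  have fix_odd : ρ ∘ oddIndex = oddIndex := funext fun b =>
    Equiv.swap_apply_of_ne_of_ne (oddIndex_ne_evenIndex b a) (oddIndex_ne_evenIndex b (0, a.2))
  have hsnd : ∀ b, (ρ b).2 = b.2 := snd_swap_apply rfl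
  have joint := (hL.identDistrib_comp ρ.injective hsnd
    ((measurable_comp_index oddIndex).prodMk (measurable_pi_apply (evenIndex a)))).map_eq
  simp only [Function.comp_assoc, fix_odd, Function.comp_apply, ρ, Equiv.swap_apply_left] at joint
  simp only [condDistrib, joint]

/-- Shifting everything but `evenIndex a` into the odd indices preserves the joint law while
shrinking the conditioning σ-algebra to a part of the one generated by the odd indices. -/
theorem condExp_evenIndex_ae_eq (hL : PartiallyExchangeable L) {U : Set (ℕ × ι)} {a : ℕ × ι}
    (hU : Set.range oddIndex ⊆ U) (ha : evenIndex a ∉ U) {s : Set E} (hs : MeasurableSet s) :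
    L⟦(fun x => x (evenIndex a)) ⁻¹' s |
        MeasurableSpace.pi.comap fun x : ℕ × ι → E => x ∘ ((↑) : U → ℕ × ι)⟧ =ᵐ[L]
      L⟦(fun x => x (evenIndex a)) ⁻¹' s |
        MeasurableSpace.pi.comap fun x : ℕ × ι → E => x ∘ oddIndex⟧ := by
  have shift_le_odd := comap_comp_index_le (E := E) oddIndex ((↑) : U → ℕ × ι)
  have odd_le_U := comap_comp_index_le (E := E) ((↑) : U → ℕ × ι)
    fun b => ⟨oddIndex b, hU ⟨b, rfl⟩⟩
  exact condExp_ae_eq_of_le_of_le shift_le_odd odd_le_U (measurable_comp_index _).comap_le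
    (condExp_preimage_ae_eq_of_identDistrib (measurable_comp_index _) (measurable_comp_index _)
      (measurable_pi_apply _) (shift_le_odd.trans odd_le_U) (hL.identDistrib_prodMk_shift ha) hs)

theorem condExp_pi_ae_eq_prod (hL : PartiallyExchangeable L) (S : Finset (ℕ × ι))
    {A : ℕ × ι → Set E} (hA : ∀ a, MeasurableSet (A a)) :
    L⟦(fun x => x ∘ evenIndex) ⁻¹' (S : Set (ℕ × ι)).pi A |
        MeasurableSpace.pi.comap fun x : ℕ × ι → E => x ∘ oddIndex⟧ =ᵐ[L]
      ∏ a ∈ S, L⟦(fun x => x (evenIndex a)) ⁻¹' A a |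
        MeasurableSpace.pi.comap fun x : ℕ × ι → E => x ∘ oddIndex⟧ := by
  induction S using Finset.induction_on with
  | empty => simp [condExp_const (measurable_comp_index oddIndex).comap_le, Pi.one_def]
  | insert a S haS ih =>
    let U : Set (ℕ × ι) := Set.range oddIndex ∪ evenIndex '' S
    have haU : evenIndex a ∉ U := by
      rintro (⟨b, hb⟩ | ⟨b, hb, hba⟩)
      · exact oddIndex_ne_evenIndex b a hb
      · exact haS (evenIndex_injective hba ▸ hb)
    set F : Set (ℕ × ι → E) := (fun x => x (evenIndex a)) ⁻¹' A a
    set B : Set (ℕ × ι → E) := (fun x => x ∘ evenIndex) ⁻¹' (S : Set (ℕ × ι)).pi A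
    have mF : MeasurableSet F := measurable_pi_apply _ (hA a)
    have mB_U : MeasurableSet[MeasurableSpace.pi.comap fun x : ℕ × ι → E =>
        x ∘ ((↑) : U → ℕ × ι)] B :=
      measurableSet_comap_preimage_pi (fun b hb => .inr ⟨b, hb, rfl⟩) hA
    have inter_eq : (fun x : ℕ × ι → E => x ∘ evenIndex) ⁻¹'
        ((insert a S : Finset (ℕ × ι)) : Set (ℕ × ι)).pi A = F ∩ B := by
      rw [Finset.coe_insert, Set.insert_pi]
      rfl
    rw [inter_eq, Finset.prod_insert haS]
    exact (condExp_inter_ae_eq_mul (comap_comp_index_le (E := E) ((↑) : U → ℕ × ι)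
      fun b => ⟨oddIndex b, .inl ⟨b, rfl⟩⟩) (measurable_comp_index _).comap_le mF mB_U
      (hL.condExp_evenIndex_ae_eq Set.subset_union_left haU (hA a))).trans (.mul .rfl ih)

theorem eq_mixedProduct (hL : PartiallyExchangeable L) :
    L = mixedProduct (L.map fun x => x ∘ oddIndex) fun a =>
      condDistrib (fun x => x (0, a.2)) (fun x => x ∘ oddIndex) L := by
  have modd : Measurable fun x : ℕ × ι → E => x ∘ oddIndex := measurable_comp_index oddIndex
  have := Measure.isProbabilityMeasure_map (μ := L) modd.aemeasurable
  refine ext_of_finset_pi fun S A hA => ?_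
  have mbox := measurableSet_finset_pi S hA
  have meven : Measurable fun x : ℕ × ι → E => x ∘ evenIndex := measurable_comp_index evenIndex
  rw [mixedProduct_pi _ _ S hA, lintegral_map
    (Finset.measurable_fun_prod _ fun a _ => Kernel.measurable_coe _ (hA a)) modd]
  have cond (a : ℕ × ι) := condDistrib_ae_eq_condExp (μ := L) modd
    (measurable_pi_apply (evenIndex a)) (hA a)
  calc L ((S : Set _).pi A)
      = L ((fun x => x ∘ evenIndex) ⁻¹' (S : Set _).pi A) := by
        rw [← Measure.map_apply meven mbox,
          hL.map_comp_of_injective evenIndex_injective fun _ => rfl]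
    _ = ∫⁻ x, ENNReal.ofReal ((L⟦(fun x => x ∘ evenIndex) ⁻¹' (S : Set (ℕ × ι)).pi A |
          MeasurableSpace.pi.comap fun x : ℕ × ι → E => x ∘ oddIndex⟧) x) ∂L :=
        measure_eq_lintegral_ofReal_condExp modd.comap_le (meven mbox)
    _ = ∫⁻ x, ∏ a ∈ S, condDistrib (fun x => x (0, a.2)) (fun x => x ∘ oddIndex) L
          (x ∘ oddIndex) (A a) ∂L := by
        refine lintegral_congr_ae ?_
        filter_upwards [hL.condExp_pi_ae_eq_prod S hA, S.eventually_all.2 fun a _ => cond a]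
          with x hx hcond
        rw [hx, Finset.prod_apply, Finset.prod_congr rfl fun a ha => (hcond a ha).symm,
          ENNReal.ofReal_prod_of_nonneg fun _ _ => measureReal_nonneg]
        exact Finset.prod_congr rfl fun a _ => by
          rw [ofReal_measureReal, hL.condDistrib_evenIndex]

end PartiallyExchangeable

end PartiallyExchangeable

theorem partiallyExchangeable_mixedProduct {Θ ι E : Type*} [DecidableEq ι] [MeasurableSpace Θ]
    [MeasurableSpace E] (γ : Measure Θ) [IsProbabilityMeasure γ] (P : ι → Kernel Θ E)
    [∀ i, IsMarkovKernel (P i)] :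
    PartiallyExchangeable (mixedProduct γ fun a : ℕ × ι => P a.2) := fun i j k => by
  rw [map_comp_perm_mixedProduct]
  simp only [snd_swap_apply (a := (k, i)) (b := (j, i)) rfl]

theorem PartiallyExchangeable.exists_eq_mixedProduct {ι : Type u} {E : Type v} [DecidableEq ι]
    [MeasurableSpace E] [StandardBorelSpace E] [Nonempty E] {L : Measure (ℕ × ι → E)}
    [IsProbabilityMeasure L] (hL : PartiallyExchangeable L) :
    ∃ (Θ : Type (max u v w)) (_ : MeasurableSpace Θ) (γ : Measure Θ) (P : ι → Kernel Θ E)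
      (_ : IsProbabilityMeasure γ) (_ : ∀ i, IsMarkovKernel (P i)),
      L = mixedProduct γ fun a : ℕ × ι => P a.2 := by
  let π := L.map fun x => x ∘ oddIndex
  have : IsProbabilityMeasure π :=
    Measure.isProbabilityMeasure_map (measurable_comp_index oddIndex).aemeasurable
  let P (i : ι) := condDistrib (fun x => x (0, i)) (fun x => x ∘ oddIndex) L
  refine ⟨ULift.{w} (ℕ × ι → E), inferInstance, π.map ULift.up,
    fun i => (P i).comap ULift.down measurable_down,
    Measure.isProbabilityMeasure_map measurable_up.aemeasurable, fun i => inferInstance, ?_⟩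
  rw [mixedProduct_map π measurable_up]
  exact hL.eq_mixedProduct

section JoinVec

theorem measurable_append {E : Type*} [MeasurableSpace E] {m n : ℕ} :
    Measurable fun z : (Fin m → E) × (Fin n → E) => Fin.append z.1 z.2 := by
  refine measurable_pi_lambda _ fun r => ?_
  induction r using Fin.addCases with
  | left i =>
    simp only [Fin.append_left]
    fun_prop
  | right i =>
    simp only [Fin.append_right]
    fun_prop

variable {p : ℕ} {Ω : Type*} [MeasurableSpace Ω] {μ : Measure Ω} {X Xt : Ω → Fin p → ℝ}

theorem aemeasurable_joinVec (hX : AEMeasurable X μ) (hXt : AEMeasurable Xt μ) :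
    AEMeasurable (joinVec X Xt) μ :=
  measurable_append.comp_aemeasurable (hX.prodMk hXt)

theorem map_joinVec_pi_append (hX : AEMeasurable X μ) (hXt : AEMeasurable Xt μ)
    {A B : Fin p → Set ℝ} (hA : ∀ i, MeasurableSet (A i)) (hB : ∀ i, MeasurableSet (B i)) :
    μ.map (joinVec X Xt) (Set.univ.pi (Fin.append A B)) =
      μ {ω | (∀ i, X ω i ∈ A i) ∧ (∀ i, Xt ω i ∈ B i)} := by
  have mbox : MeasurableSet (Set.univ.pi (Fin.append A B)) := MeasurableSet.univ_pi fun r => by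
    induction r using Fin.addCases with
    | left i => simpa only [Fin.append_left] using hA i
    | right i => simpa only [Fin.append_right] using hB i
  rw [Measure.map_apply_of_aemeasurable (aemeasurable_joinVec hX hXt) mbox]
  congr 1 with ω
  simp only [joinVec, Set.mem_preimage, Set.mem_pi, Set.mem_univ, forall_const, Set.mem_ofPred_eq,
    Fin.forall_fin_add, Fin.append_left, Fin.append_right]

theorem identDistrib_joinVec_iff {Ω' : Type*} [MeasurableSpace Ω'] {ν : Measure Ω'}
    [IsFiniteMeasure ν] {X' Xt' : Ω' → Fin p → ℝ} (hX : AEMeasurable X μ)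
    (hXt : AEMeasurable Xt μ) (hX' : AEMeasurable X' ν) (hXt' : AEMeasurable Xt' ν) :
    IdentDistrib (joinVec X Xt) (joinVec X' Xt') μ ν ↔
      ∀ A B : Fin p → Set ℝ, (∀ i, MeasurableSet (A i)) → (∀ i, MeasurableSet (B i)) →
        μ {ω | (∀ i, X ω i ∈ A i) ∧ (∀ i, Xt ω i ∈ B i)} =
          ν {ω | (∀ i, X' ω i ∈ A i) ∧ (∀ i, Xt' ω i ∈ B i)} := by
  refine ⟨fun h A B hA hB => ?_, fun h =>
    ⟨aemeasurable_joinVec hX hXt, aemeasurable_joinVec hX' hXt', ?_⟩⟩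
  · rw [← map_joinVec_pi_append hX hXt hA hB, h.map_eq, map_joinVec_pi_append hX' hXt' hA hB]
  · have box_eq (s : Fin (p + p) → Set ℝ) (hs : ∀ r, MeasurableSet (s r)) :
        ν.map (joinVec X' Xt') (Set.univ.pi s) = μ.map (joinVec X Xt) (Set.univ.pi s) := by
      rw [← Fin.append_castAdd_natAdd (f := s), map_joinVec_pi_append hX hXt (fun _ => hs _)
        fun _ => hs _, map_joinVec_pi_append hX' hXt' (fun _ => hs _) fun _ => hs _]
      exact (h _ _ (fun _ => hs _) fun _ => hs _).symm
    refine (ext_of_generate_finite _ generateFrom_pi.symm isPiSystem_pi ?_ ?_).symm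
    · rintro _ ⟨s, hs, rfl⟩
      exact box_eq s fun r => hs r (Set.mem_univ r)
    · simpa only [Set.pi_univ] using box_eq (fun _ => Set.univ) fun _ => .univ

end JoinVec

section Copies

/-- The `k`-th row of an array, which holds the `k`-th element of each type. -/
def copyAt {ι E : Type*} (k : ℕ) (x : ℕ × ι → E) : ι → E := fun i => x (k, i)

theorem measurable_copyAt {ι E : Type*} [MeasurableSpace E] (k : ℕ) :
    Measurable (copyAt k : (ℕ × ι → E) → ι → E) :=
  measurable_comp_index fun i => (k, i)

theorem mixedProduct_setOf_copyAt_mem {Θ ι E : Type*} [Fintype ι] [MeasurableSpace Θ]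
    [MeasurableSpace E] (γ : Measure Θ) (P : ι → Kernel Θ E) [∀ i, IsMarkovKernel (P i)]
    {A B : ι → Set E} (hA : ∀ i, MeasurableSet (A i)) (hB : ∀ i, MeasurableSet (B i)) :
    mixedProduct γ (fun a : ℕ × ι => P a.2)
        {x | (∀ i, copyAt 0 x i ∈ A i) ∧ (∀ i, copyAt 1 x i ∈ B i)} =
      ∫⁻ θ, ∏ i, (P i θ (A i) * P i θ (B i)) ∂γ := by
  let C (a : ℕ × ι) : Set E := if a.1 = 0 then A a.2 else B a.2
  have hC (a : ℕ × ι) : MeasurableSet (C a) := by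
    dsimp only [C]
    split_ifs
    exacts [hA _, hB _]
  have box_eq : {x : ℕ × ι → E | (∀ i, copyAt 0 x i ∈ A i) ∧ (∀ i, copyAt 1 x i ∈ B i)} =
      ((Finset.range 2 ×ˢ Finset.univ : Finset (ℕ × ι)) : Set (ℕ × ι)).pi C := by
    ext x
    constructor
    · rintro ⟨hxA, hxB⟩ ⟨k, i⟩ hk
      obtain rfl | rfl : k = 0 ∨ k = 1 := by grind
      exacts [hxA i, hxB i]
    · exact fun hx => ⟨fun i => hx (0, i) (by simp), fun i => hx (1, i) (by simp)⟩
  rw [box_eq, mixedProduct_pi γ _ _ hC]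
  simp [Finset.prod_product, Finset.prod_range_succ, Finset.prod_mul_distrib, C]

variable {Ω : Type u} [MeasurableSpace Ω] {μ : Measure Ω} {p : ℕ} {X Xt : Ω → Fin p → ℝ}

theorem isCIK_iff (hX : AEMeasurable X μ) (hXt : AEMeasurable Xt μ) :
    IsCIK.{u, w} X Xt μ ↔
      ∃ (Θ : Type w) (_ : MeasurableSpace Θ) (γ : Measure Θ) (P : Fin p → Kernel Θ ℝ)
        (_ : IsProbabilityMeasure γ) (_ : ∀ i, IsMarkovKernel (P i)),
        IdentDistrib (joinVec X Xt) (joinVec (copyAt 0) (copyAt 1)) μ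
          (mixedProduct γ fun a : ℕ × Fin p => P a.2) := by
  have row_iff {Θ : Type w} [MeasurableSpace Θ] (γ : Measure Θ) [IsProbabilityMeasure γ]
      (P : Fin p → Kernel Θ ℝ) [∀ i, IsMarkovKernel (P i)] :=
    identDistrib_joinVec_iff (ν := mixedProduct γ fun a : ℕ × Fin p => P a.2) hX hXt
      (measurable_copyAt 0).aemeasurable (measurable_copyAt 1).aemeasurable
  constructor
  · rintro ⟨Θ, _, γ, P, _, _, hP⟩
    refine ⟨Θ, _, γ, P, inferInstance, inferInstance, (row_iff γ P).2 fun A B hA hB => ?_⟩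
    rw [mixedProduct_setOf_copyAt_mem γ P hA hB, hP A B hA hB]
  · rintro ⟨Θ, _, γ, P, _, _, hP⟩
    refine ⟨Θ, _, γ, P, inferInstance, inferInstance, fun A B hA hB => ?_⟩
    rw [(row_iff γ P).1 hP A B hA hB, mixedProduct_setOf_copyAt_mem γ P hA hB]

end Copies

section Sequence

variable {p : ℕ}

/-- The position in a sequence of the element `a` of an array with `p` types, when the rows of the
array are written one after the other. -/
def seqIndex (a : ℕ × Fin p) : ℕ := a.1 * p + a.2

theorem seqIndex_injective : Function.Injective (seqIndex (p := p)) := fun a b h => by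
  have : NeZero p := ⟨a.2.pos.ne'⟩
  exact (Nat.divModEquiv p).symm.injective h

theorem append_copyAt_comp_seqIndex (y : ℕ → ℝ) :
    Fin.append (copyAt 0 (y ∘ seqIndex)) (copyAt 1 (y ∘ seqIndex)) =
      fun r : Fin (p + p) => y r := by
  funext r
  induction r using Fin.addCases with
  | left i => simp only [Fin.append_left, copyAt, Function.comp_apply, seqIndex, zero_mul, zero_add,
      Fin.val_castAdd]
  | right i => simp only [Fin.append_right, copyAt, Function.comp_apply, seqIndex, one_mul,
      Fin.val_natAdd]

theorem swapSeq_comp_seqIndex [DecidableEq (ℕ × Fin p)] (i : Fin p) (j k : ℕ) (y : ℕ → ℝ) :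
    swapSeq i j k y ∘ seqIndex = (y ∘ seqIndex) ∘ Equiv.swap (k, i) (j, i) :=
  funext fun a => congrArg y (seqIndex_injective.map_swap (k, i) (j, i) a).symm

theorem extend_comp_swap {α β γ : Type*} [DecidableEq α] [DecidableEq β] {f : α → β}
    (hf : Function.Injective f) (a b : α) (x : α → γ) (c : γ) :
    Function.extend f x (fun _ => c) ∘ Equiv.swap (f a) (f b) =
      Function.extend f (x ∘ Equiv.swap a b) fun _ => c := by
  funext z
  by_cases hz : ∃ t, f t = z
  · obtain ⟨t, rfl⟩ := hz
    rw [Function.comp_apply, ← hf.map_swap, hf.extend_apply, hf.extend_apply, Function.comp_apply]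
  · have hza : z ≠ f a := fun h => hz ⟨a, h.symm⟩
    have hzb : z ≠ f b := fun h => hz ⟨b, h.symm⟩
    rw [Function.comp_apply, Equiv.swap_apply_of_ne_of_ne hza hzb, Function.extend_apply' _ _ _ hz,
      Function.extend_apply' _ _ _ hz]

variable {Ω : Type u} [MeasurableSpace Ω] {μ : Measure Ω} {X Xt : Ω → Fin p → ℝ}

theorem measurable_joinVec_copyAt :
    Measurable (joinVec (copyAt 0) (copyAt 1) : (ℕ × Fin p → ℝ) → _) :=
  measurable_append.comp ((measurable_copyAt 0).prodMk (measurable_copyAt 1))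

theorem InfinitelyExtendable.exists_partiallyExchangeable
    (h : InfinitelyExtendable.{u, v} X Xt μ) :
    ∃ (L : Measure (ℕ × Fin p → ℝ)) (_ : IsProbabilityMeasure L), PartiallyExchangeable L ∧
      IdentDistrib (joinVec X Xt) (joinVec (copyAt 0) (copyAt 1)) μ L := by
  obtain ⟨Ω', _, ν, V, _, hV, hVX, hswap⟩ := h
  have marray : Measurable fun y : ℕ → ℝ => y ∘ seqIndex (p := p) := measurable_comp_index _
  have mV_array : Measurable fun ω => V ω ∘ seqIndex (p := p) := marray.comp hV
  refine ⟨ν.map fun ω => V ω ∘ seqIndex,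
    Measure.isProbabilityMeasure_map mV_array.aemeasurable, fun i j k => ?_, ?_⟩
  · have hswap_array := ((hswap i j k).comp marray).map_eq
    simp only [Function.comp_def (f := fun y : ℕ → ℝ => y ∘ seqIndex),
      swapSeq_comp_seqIndex] at hswap_array
    rw [Measure.map_map (measurable_comp_index _) mV_array]
    exact hswap_array
  · have rows := identDistrib_comp_map (μ := ν) measurable_joinVec_copyAt mV_array
    simp only [joinVec, append_copyAt_comp_seqIndex] at rows
    exact hVX.symm.trans rows

theorem PartiallyExchangeable.infinitelyExtendable {L : Measure (ℕ × Fin p → ℝ)}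
    [IsProbabilityMeasure L] (hL : PartiallyExchangeable L)
    (h : IdentDistrib (joinVec X Xt) (joinVec (copyAt 0) (copyAt 1)) μ L) :
    InfinitelyExtendable.{u, v} X Xt μ := by
  let toSeq (x : ℕ × Fin p → ℝ) : ℕ → ℝ := Function.extend seqIndex x fun _ => 0
  have mtoSeq : Measurable toSeq := measurable_extend_index seqIndex _
  have lift {β : Type} [MeasurableSpace β] {g : (ℕ × Fin p → ℝ) → β} (hg : Measurable g) :
      IdentDistrib g (fun ω : ULift.{v} (ℕ × Fin p → ℝ) => g ω.down) L (L.map ULift.up) :=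
    identDistrib_comp_map (hg.comp measurable_down) measurable_up
  refine ⟨ULift.{v} (ℕ × Fin p → ℝ), inferInstance, L.map ULift.up, fun ω => toSeq ω.down,
    Measure.isProbabilityMeasure_map measurable_up.aemeasurable, mtoSeq.comp measurable_down,
    ?_, fun i j k => ?_⟩
  · have rows_eq : (fun x (r : Fin (p + p)) => toSeq x r) = joinVec (copyAt 0) (copyAt 1) := by
      funext x
      rw [← append_copyAt_comp_seqIndex, Function.extend_comp seqIndex_injective]
      rfl
    have rows := lift measurable_joinVec_copyAt
    rw [← rows_eq] at rows h
    exact rows.symm.trans h.symm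
  · have swap_eq : (fun x => swapSeq i j k (toSeq x)) =
        fun x => toSeq (x ∘ Equiv.swap (k, i) (j, i)) :=
      funext fun x => extend_comp_swap seqIndex_injective (k, i) (j, i) x 0
    have invariant : IdentDistrib (fun x => swapSeq i j k (toSeq x)) toSeq L L := by
      rw [swap_eq]
      convert identDistrib_comp_map (μ := L) mtoSeq (measurable_comp_index _)
      exact (hL i j k).symm
    exact ((lift (swap_eq ▸ mtoSeq.comp (measurable_comp_index _))).symm.trans invariant).trans
      (lift mtoSeq)

end Sequence

theorem theorem3_general {Ω : Type u} [MeasurableSpace Ω] (μ : Measure Ω) {p : ℕ}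
    {X Xt : Ω → Fin p → ℝ} (hX : AEMeasurable X μ) (hXt : AEMeasurable Xt μ) :
    IsCIK.{u, w} X Xt μ ↔ InfinitelyExtendable.{u, v} X Xt μ := by
  rw [isCIK_iff hX hXt]
  constructor
  · rintro ⟨Θ, _, γ, P, _, _, hP⟩
    exact (partiallyExchangeable_mixedProduct γ P).infinitelyExtendable hP
  · intro h
    obtain ⟨L, _, hL, hrows⟩ := h.exists_partiallyExchangeable
    obtain ⟨Θ, _, γ, P, _, _, rfl⟩ := hL.exists_eq_mixedProduct
    exact ⟨Θ, _, γ, P, inferInstance, inferInstance, hrows⟩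

theorem theorem3 {Ω : Type u} [MeasurableSpace Ω] (μ : Measure Ω) [IsProbabilityMeasure μ]
    {p : ℕ} (X Xt : Ω → Fin p → ℝ) (Y : Ω → ℝ)
    (hX : Measurable X) (hXt : Measurable Xt) (hY : Measurable Y)
    (hK : IsKnockoff X Xt Y μ) :
    IsCIK.{u, w} X Xt μ ↔ InfinitelyExtendable.{u, v} X Xt μ :=
  theorem3_general μ hX.aemeasurable hXt.aemeasurable
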